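/- Let $n\ge 0$. Equip $\mathbb{CP}^n$ with the Fubini--Study form $\omega_{FS}$ (in homogeneous coordinates, $\omega_{FS}=\frac{i}{2}\partial\bar\partial\log|z|^2$), and let $\mathrm{Symp}(\mathbb{CP}^n,\omega_{FS})$ be the group of diffeomorphisms of $\mathbb{CP}^n$ that preserve $\omega_{FS}$, with the $C^\infty$ topology. Let $PU(n+1)=U(n+1)/U(1)$ be the projective unitary group with the quotient topology, and let $$\iota:PU(n+1)\longrightarrow \mathrm{Symp}(\mathbb{CP}^n,\omega_{FS}),\qquad \iota([A])([z])=[Az],$$ be the (continuous) inclusion. Then the induced map $$\pi_j(\iota):\pi_j(PU(n+1),1)\longrightarrow\pi_j(\mathrm{Symp}(\mathbb{CP}^n,\omega_{FS}),\mathrm{id})$$ is injective for every $j\le 2n+1$. -/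

import Mathlib

open scoped Manifold ContDiff Topology LinearAlgebra.Projectivization Matrix
open Set

noncomputable section

/-! ### The `C^∞` topology on diffeomorphism groups and symplectomorphism groups -/

section Diffeomorphisms

variable {E : Type*} [NormedAddCommGroup E] [NormedSpace ℝ E]
  {M : Type*} [TopologicalSpace M] [ChartedSpace E M]

/-- The diffeomorphisms of a manifold form a group under composition. -/
instance Diffeomorph.instGroupSelf : Group (M ≃ₘ⟮𝓘(ℝ, E), 𝓘(ℝ, E)⟯ M) where
  mul φ ψ := ψ.trans φ
  one := Diffeomorph.refl 𝓘(ℝ, E) M ∞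
  inv φ := φ.symm
  mul_assoc _ _ _ := rfl
  one_mul _ := rfl
  mul_one _ := rfl
  inv_mul_cancel φ := Diffeomorph.ext fun x => φ.symm_apply_apply x

theorem Diffeomorph.mul_def' (φ ψ : M ≃ₘ⟮𝓘(ℝ, E), 𝓘(ℝ, E)⟯ M) :
    (⇑(φ * ψ) : M → M) = φ ∘ ψ := rfl

theorem Diffeomorph.one_def' : (⇑(1 : M ≃ₘ⟮𝓘(ℝ, E), 𝓘(ℝ, E)⟯ M) : M → M) = id := rfl

/-- A basic neighbourhood in the `C^∞` topology: the diffeomorphisms `g` which, read in the charts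
`c` and `c'`, are `ε`-close to `f` on `K` together with their derivatives of order at most `k`. -/
def Diffeomorph.cInftyNhd (f : M ≃ₘ⟮𝓘(ℝ, E), 𝓘(ℝ, E)⟯ M) (c c' : OpenPartialHomeomorph M E)
    (K : Set E) (k : ℕ) (ε : ℝ) : Set (M ≃ₘ⟮𝓘(ℝ, E), 𝓘(ℝ, E)⟯ M) :=
  {g | MapsTo g (c.symm '' K) c'.source ∧ ∀ i ≤ k, ∀ x ∈ K,
    ‖iteratedFDeriv ℝ i (c' ∘ g ∘ c.symm) x - iteratedFDeriv ℝ i (c' ∘ f ∘ c.symm) x‖ < ε}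

/-- The `C^∞` topology on the group of diffeomorphisms of a manifold (uniform convergence of all
derivatives in charts on compact sets). -/
instance Diffeomorph.instTopologicalSpaceSelf :
    TopologicalSpace (M ≃ₘ⟮𝓘(ℝ, E), 𝓘(ℝ, E)⟯ M) :=
  TopologicalSpace.generateFrom
    {S | ∃ (f : M ≃ₘ⟮𝓘(ℝ, E), 𝓘(ℝ, E)⟯ M) (c c' : OpenPartialHomeomorph M E)
      (K : Set E) (k : ℕ) (ε : ℝ),
      c ∈ IsManifold.maximalAtlas 𝓘(ℝ, E) ∞ M ∧ c' ∈ IsManifold.maximalAtlas 𝓘(ℝ, E) ∞ M ∧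
      IsCompact K ∧ K ⊆ c.target ∧ MapsTo f (c.symm '' K) c'.source ∧ 0 < ε ∧
      S = Diffeomorph.cInftyNhd f c c' K k ε}

/-- The group of diffeomorphisms preserving a field `σ` of real-valued forms in two tangent
vectors. It carries the subspace topology of the `C^∞` topology. -/
def Symp (σ : ∀ p : M, TangentSpace 𝓘(ℝ, E) p → TangentSpace 𝓘(ℝ, E) p → ℝ) :
    Subgroup (M ≃ₘ⟮𝓘(ℝ, E), 𝓘(ℝ, E)⟯ M) where
  carrier := {φ | ∀ (p : M) (u v : TangentSpace 𝓘(ℝ, E) p),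
    σ (φ p) (mfderiv 𝓘(ℝ, E) 𝓘(ℝ, E) φ p u) (mfderiv 𝓘(ℝ, E) 𝓘(ℝ, E) φ p v) = σ p u v}
  one_mem' := fun p u v => by
    rw [Diffeomorph.one_def', mfderiv_id]; rfl
  mul_mem' := fun {φ ψ} hφ hψ p u v => by
    rw [Diffeomorph.mul_def', mfderiv_comp p (φ.mdifferentiable (by simp) _)
      (ψ.mdifferentiable (by simp) _)]
    exact (hφ (ψ p) _ _).trans (hψ p u v)
  inv_mem' := fun {φ} hφ p u v => by
    have key : (mfderiv 𝓘(ℝ, E) 𝓘(ℝ, E) φ (φ.symm p)).comp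
        (mfderiv 𝓘(ℝ, E) 𝓘(ℝ, E) φ.symm p) = ContinuousLinearMap.id ℝ _ := by
      rw [← mfderiv_comp p (φ.mdifferentiable (by simp) _) (φ.symm.mdifferentiable (by simp) _)]
      have : (φ ∘ φ.symm : M → M) = id := funext fun x => φ.apply_symm_apply x
      rw [this, mfderiv_id]
    have h := hφ (φ.symm p) (mfderiv 𝓘(ℝ, E) 𝓘(ℝ, E) φ.symm p u)
      (mfderiv 𝓘(ℝ, E) 𝓘(ℝ, E) φ.symm p v)
    have cast : ∀ q : M, q = p → ∀ a b : E, σ q a b = σ p a b := by rintro _ rfl _ _; rfl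
    have ku := congrArg (fun L => L u) key
    have kv := congrArg (fun L => L v) key
    refine h.symm.trans ((cast _ (φ.apply_symm_apply p) _ _).trans ?_)
    exact congrArg₂ (σ p) ku kv

end Diffeomorphisms

/-! ### Induced maps on homotopy groups -/

/-- The map `π_N(X, x) → π_N(Y, y)` induced by a continuous map `f` with `f x = y`. -/
def homotopyGroupMap (N : Type*) {X Y : Type*} [TopologicalSpace X] [TopologicalSpace Y]
    (f : C(X, Y)) {x : X} {y : Y} (h : f x = y) : HomotopyGroup N X x → HomotopyGroup N Y y :=
  Quotient.map
    (fun γ => ⟨f.comp γ.1, fun t ht => (congrArg f (γ.2 t ht)).trans h⟩)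
    (fun _ _ hγ => hγ.map fun H => H.compContinuousMap f)

/-! ### Complex projective space -/

/-- Complex projective space `ℂℙⁿ`: the lines in `ℂⁿ⁺¹`. -/
abbrev CP (n : ℕ) : Type := ℙ ℂ (Fin (n + 1) → ℂ)

namespace CP

variable {n : ℕ}

/-- The quotient topology from `ℂⁿ⁺¹ ∖ {0}`. -/
instance : TopologicalSpace (CP n) :=
  inferInstanceAs (TopologicalSpace (Quotient (projectivizationSetoid ℂ (Fin (n + 1) → ℂ))))

theorem isQuotientMap_mk' : Topology.IsQuotientMap
    (Projectivization.mk' ℂ : {v : Fin (n + 1) → ℂ // v ≠ 0} → CP n) :=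
  isQuotientMap_quotient_mk'

theorem insertNth_ne_zero (i : Fin (n + 1)) (x : Fin n → ℂ) :
    (i.insertNth (1 : ℂ) x : Fin (n + 1) → ℂ) ≠ 0 := fun h => by
  simpa using congrFun h i

/-- The `i`-th affine coordinates `z_k / z_i`, `k ≠ i`, as a function on `ℂⁿ⁺¹`. -/
def affCoord (i : Fin (n + 1)) (z : Fin (n + 1) → ℂ) : Fin n → ℂ :=
  fun k => z (i.succAbove k) / z i

theorem affCoord_smul (i : Fin (n + 1)) (z : Fin (n + 1) → ℂ) {t : ℂ} (ht : t ≠ 0) :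
    affCoord i (t • z) = affCoord i z := by
  ext k; simp [affCoord, mul_div_mul_left _ _ ht]

theorem insertNth_affCoord (i : Fin (n + 1)) (z : Fin (n + 1) → ℂ) (hz : z i ≠ 0) :
    (i.insertNth (1 : ℂ) (affCoord i z) : Fin (n + 1) → ℂ) = (z i)⁻¹ • z := by
  ext m
  rcases Fin.eq_self_or_eq_succAbove i m with rfl | ⟨k, rfl⟩
  · simp [hz]
  · simp [affCoord, div_eq_inv_mul]

theorem affCoord_insertNth (i : Fin (n + 1)) (x : Fin n → ℂ) :
    affCoord i (i.insertNth (1 : ℂ) x) = x := by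
  ext k; simp [affCoord]

theorem rep_mk_ne_zero_iff (i : Fin (n + 1)) (z : Fin (n + 1) → ℂ) (hz : z ≠ 0) :
    (Projectivization.mk ℂ z hz).rep i ≠ 0 ↔ z i ≠ 0 := by
  obtain ⟨a, ha⟩ := Projectivization.exists_smul_eq_mk_rep ℂ z hz
  rw [← ha]; simp [Units.smul_def]

theorem continuousOn_affCoord (i : Fin (n + 1)) :
    ContinuousOn (affCoord i) {z : Fin (n + 1) → ℂ | z i ≠ 0} := by
  refine continuousOn_pi.2 fun k => ?_
  exact ContinuousOn.div (by fun_prop) (by fun_prop) fun z hz => hz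

theorem continuous_insertNth (i : Fin (n + 1)) (a : ℂ) :
    Continuous fun x : Fin n → ℂ => (i.insertNth a x : Fin (n + 1) → ℂ) := by
  refine continuous_pi fun m => ?_
  rcases Fin.eq_self_or_eq_succAbove i m with rfl | ⟨k, rfl⟩
  · simpa using continuous_const
  · simpa using continuous_apply k

theorem isOpen_rep_ne_zero (i : Fin (n + 1)) : IsOpen {p : CP n | p.rep i ≠ 0} := by
  rw [← isQuotientMap_mk'.isOpen_preimage]
  have : (Projectivization.mk' ℂ ⁻¹' {p : CP n | p.rep i ≠ 0}) =
      (fun v : {v : Fin (n + 1) → ℂ // v ≠ 0} => v.1 i) ⁻¹' {0}ᶜ := by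
    ext v
    exact rep_mk_ne_zero_iff i v.1 v.2
  rw [this]
  exact isOpen_compl_singleton.preimage ((continuous_apply i).comp continuous_subtype_val)

/-- The affine chart `[z₀ : … : zₙ] ↦ (z_k / z_i)_{k ≠ i}`, defined where `z_i ≠ 0`. -/
def affineChart (i : Fin (n + 1)) : OpenPartialHomeomorph (CP n) (Fin n → ℂ) where
  toFun := Projectivization.lift (fun v => affCoord i v.1) (by
    rintro ⟨a, ha⟩ ⟨b, hb⟩ t h
    simp only at h
    have ht : t ≠ 0 := by rintro rfl; exact ha (by simpa using h)
    simp only [h, affCoord_smul i b ht])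
  invFun x := Projectivization.mk ℂ (i.insertNth (1 : ℂ) x) (insertNth_ne_zero i x)
  source := {p | p.rep i ≠ 0}
  target := univ
  map_source' _ _ := mem_univ _
  map_target' x _ := by
    rw [mem_ofPred_eq, rep_mk_ne_zero_iff]; simp
  left_inv' p hp := by
    induction p using Projectivization.ind with | h z hz =>
    rw [mem_ofPred_eq, rep_mk_ne_zero_iff] at hp
    rw [Projectivization.lift_mk, Projectivization.mk_eq_mk_iff']
    exact ⟨(z i)⁻¹, (insertNth_affCoord i z hp).symm⟩
  right_inv' x _ := by
    rw [Projectivization.lift_mk]; exact affCoord_insertNth i x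
  open_source := isOpen_rep_ne_zero i
  open_target := isOpen_univ
  continuousOn_toFun := by
    rw [isQuotientMap_mk'.continuousOn_isOpen_iff (isOpen_rep_ne_zero i)]
    refine (continuousOn_affCoord i).comp continuous_subtype_val.continuousOn fun v hv => ?_
    exact (rep_mk_ne_zero_iff i v.1 v.2).1 hv
  continuousOn_invFun := by
    refine Continuous.continuousOn ?_
    exact isQuotientMap_mk'.continuous.comp
      ((continuous_insertNth i 1).subtype_mk (insertNth_ne_zero i))

theorem exists_rep_ne_zero (p : CP n) : ∃ i, p.rep i ≠ 0 := by
  by_contra! h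
  exact p.rep_nonzero (funext h)

/-- An index `i` with `z_i ≠ 0` at the point `p = [z]`. -/
def idx (p : CP n) : Fin (n + 1) := (exists_rep_ne_zero p).choose

theorem rep_idx_ne_zero (p : CP n) : p.rep p.idx ≠ 0 := (exists_rep_ne_zero p).choose_spec

/-- The atlas of affine charts. -/
instance : ChartedSpace (Fin n → ℂ) (CP n) where
  atlas := range affineChart
  chartAt p := affineChart p.idx
  mem_chart_source := rep_idx_ne_zero
  chart_mem_atlas _ := mem_range_self _


theorem affineChart_symm (i : Fin (n + 1)) (x : Fin n → ℂ) : (affineChart i).symm x =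
    Projectivization.mk ℂ (i.insertNth (1 : ℂ) x) (insertNth_ne_zero i x) := rfl

theorem mk_mem_source (i : Fin (n + 1)) (z : Fin (n + 1) → ℂ) (hz : z ≠ 0) :
    Projectivization.mk ℂ z hz ∈ (affineChart i).source ↔ z i ≠ 0 :=
  rep_mk_ne_zero_iff i z hz

theorem contDiffAt_affCoord (i : Fin (n + 1)) {z : Fin (n + 1) → ℂ} (hz : z i ≠ 0) :
    ContDiffAt ℝ ∞ (affCoord i) z := by
  refine contDiffAt_pi.2 fun k => ?_
  have h1 : ContDiffAt ℝ ∞ (fun z : Fin (n + 1) → ℂ => z (i.succAbove k)) z := by fun_prop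
  have h2 : ContDiffAt ℝ ∞ (fun z : Fin (n + 1) → ℂ => z i) z := by fun_prop
  exact (h1.mul (h2.inv hz)).congr_of_eventuallyEq
    (Filter.Eventually.of_forall fun w => div_eq_mul_inv _ _)

theorem contDiff_insertNth (i : Fin (n + 1)) (a : ℂ) :
    ContDiff ℝ ∞ fun x : Fin n → ℂ => (i.insertNth a x : Fin (n + 1) → ℂ) := by
  refine contDiff_pi.2 fun m => ?_
  rcases Fin.eq_self_or_eq_succAbove i m with rfl | ⟨k, rfl⟩
  · simpa using contDiff_const
  · simpa using contDiff_apply ℝ ℂ k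

/-- The affine charts make `ℂℙⁿ` a smooth manifold. -/
instance : IsManifold 𝓘(ℝ, Fin n → ℂ) ∞ (CP n) := by
  refine isManifold_of_contDiffOn _ _ _ ?_
  rintro _ _ ⟨i, rfl⟩ ⟨j, rfl⟩ x hx
  have hx' : (affineChart i).symm x ∈ (affineChart j).source := by
    have : x ∈ (affineChart i).target ∧ (affineChart i).symm x ∈ (affineChart j).source := by
      simpa using hx
    exact this.2
  rw [affineChart_symm, mk_mem_source] at hx'
  exact ((contDiffAt_affCoord j hx').comp x
    (contDiff_insertNth i 1).contDiffAt).contDiffWithinAt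

/-! ### The Fubini–Study form -/

/-- The Fubini–Study form in homogeneous coordinates: the value of
`(i/2) ∂∂̄ log |z|²` at the point `z ∈ ℂⁿ⁺¹ ∖ {0}` on the vectors `a`, `b`. -/
def fsForm (z a b : Fin (n + 1) → ℂ) : ℝ :=
  ((star a ⬝ᵥ b) * (star z ⬝ᵥ z) - (star a ⬝ᵥ z) * (star z ⬝ᵥ b)).im / (star z ⬝ᵥ z).re ^ 2

/-- The Fubini–Study form `ω_FS` on `ℂℙⁿ`. A tangent vector at `p` is given in the affine
chart at `p`, and is the image of the velocity vector of the local section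
`x ↦ (x₁, …, 1, …, xₙ)` of `ℂⁿ⁺¹ ∖ {0} → ℂℙⁿ`. -/
def fubiniStudy (p : CP n) (u v : TangentSpace 𝓘(ℝ, Fin n → ℂ) p) : ℝ :=
  fsForm (p.idx.insertNth (1 : ℂ) (affineChart p.idx p))
    (p.idx.insertNth (0 : ℂ) (show Fin n → ℂ from u))
    (p.idx.insertNth (0 : ℂ) (show Fin n → ℂ from v))

theorem fsForm_smul_add (z a b : Fin (n + 1) → ℂ) {c : ℂ} (hc : c ≠ 0) (s t : ℂ) :
    fsForm (c • z) (c • a + s • z) (c • b + t • z) = fsForm z a b := by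
  have hz : ∃ r : ℝ, star z ⬝ᵥ z = r := by
    refine ⟨(star z ⬝ᵥ z).re, ?_⟩
    rw [Complex.ext_iff]
    refine ⟨by simp, ?_⟩
    have : star (star z ⬝ᵥ z) = star z ⬝ᵥ z := (Matrix.star_dotProduct z z).symm
    simpa using Complex.conj_eq_iff_im.1 this
  obtain ⟨r, hr⟩ := hz
  have hcc : star c * c = (Complex.normSq c : ℂ) := by
    rw [mul_comm]; exact Complex.mul_conj c
  have hN : Complex.normSq c ≠ 0 := by simpa using hc
  have h1 : star (c • z) ⬝ᵥ (c • z) = (Complex.normSq c * r : ℝ) := by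
    simp only [star_smul, smul_dotProduct, dotProduct_smul, smul_eq_mul, hr]
    push_cast; rw [← hcc]; ring
  have h2 : (star (c • a + s • z) ⬝ᵥ (c • b + t • z)) * (star (c • z) ⬝ᵥ (c • z)) -
      (star (c • a + s • z) ⬝ᵥ (c • z)) * (star (c • z) ⬝ᵥ (c • b + t • z)) =
      ((Complex.normSq c ^ 2 : ℝ) : ℂ) *
        ((star a ⬝ᵥ b) * (star z ⬝ᵥ z) - (star a ⬝ᵥ z) * (star z ⬝ᵥ b)) := by
    simp only [star_add, star_smul, add_dotProduct, dotProduct_add, smul_dotProduct,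
      dotProduct_smul, smul_eq_mul]
    push_cast; rw [← hcc]; ring
  rw [fsForm, h2, h1, fsForm, hr, Complex.im_ofReal_mul, Complex.ofReal_re, Complex.ofReal_re,
    mul_pow, mul_div_mul_left _ _ (pow_ne_zero 2 hN)]

theorem insertNth_fderiv_affCoord (i : Fin (n + 1)) {z : Fin (n + 1) → ℂ} (hz : z i ≠ 0)
    (a : Fin (n + 1) → ℂ) :
    (i.insertNth (0 : ℂ) (fderiv ℝ (affCoord i) z a) : Fin (n + 1) → ℂ) =
      (z i)⁻¹ • a + (-(a i) / (z i) ^ 2) • z := by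
  have hd := ((contDiffAt_affCoord i hz).differentiableAt (by simp)).hasFDerivAt
  have hline : HasDerivAt (fun t : ℝ => z + t • a) a 0 := by
    simpa using ((hasDerivAt_id (0 : ℝ)).smul_const a).const_add z
  have hc : HasDerivAt (fun t : ℝ => affCoord i (z + t • a)) (fderiv ℝ (affCoord i) z a) 0 := by
    have hd' : HasFDerivAt (affCoord i) (fderiv ℝ (affCoord i) z) (z + (0 : ℝ) • a) := by
      simpa using hd
    exact hd'.comp_hasDerivAt 0 hline
  ext m
  rcases Fin.eq_self_or_eq_succAbove i m with rfl | ⟨k, rfl⟩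
  · simp; field_simp; ring
  · have hm : ∀ m, HasDerivAt (fun t : ℝ => (z + t • a) m) (a m) 0 := hasDerivAt_pi.1 hline
    have h1 := (hm (i.succAbove k)).fun_div (hm i) (by simpa using hz)
    have h2 := (hasDerivAt_pi.1 hc k).unique h1
    simp only [Fin.insertNth_apply_succAbove, h2]
    simp; field_simp; ring

/-- The Fubini–Study form in the `i`-th affine coordinates. -/
theorem fsForm_affCoord (i : Fin (n + 1)) {z : Fin (n + 1) → ℂ} (hz : z i ≠ 0)
    (a b : Fin (n + 1) → ℂ) :
    fsForm (i.insertNth (1 : ℂ) (affCoord i z)) (i.insertNth (0 : ℂ) (fderiv ℝ (affCoord i) z a))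
      (i.insertNth (0 : ℂ) (fderiv ℝ (affCoord i) z b)) = fsForm z a b := by
  rw [insertNth_fderiv_affCoord i hz, insertNth_fderiv_affCoord i hz, insertNth_affCoord i z hz]
  exact fsForm_smul_add z a b (inv_ne_zero hz) _ _

/-- In homogeneous coordinates: the pull-back of `ω_FS` to `ℂⁿ⁺¹ ∖ {0}` is `fsForm`. -/
theorem fubiniStudy_mk (z : Fin (n + 1) → ℂ) (hz : z ≠ 0) (a b : Fin (n + 1) → ℂ) :
    fubiniStudy (Projectivization.mk ℂ z hz)
      (fderiv ℝ (affCoord (idx (Projectivization.mk ℂ z hz))) z a)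
      (fderiv ℝ (affCoord (idx (Projectivization.mk ℂ z hz))) z b) = fsForm z a b :=
  fsForm_affCoord _ ((rep_mk_ne_zero_iff _ z hz).1 (rep_idx_ne_zero _)) a b

/-! ### The action of the unitary group -/

open Matrix in
theorem mulVec_injective (A : unitaryGroup (Fin (n + 1)) ℂ) :
    Function.Injective (A.1.mulVecLin) := by
  intro v w h
  have := congrArg (fun x => (star A.1) *ᵥ x) h
  simpa [mulVec_mulVec] using this

/-- The map `[z] ↦ [A z]` of `ℂℙⁿ` given by a unitary matrix `A`. -/
def unitaryMap (A : Matrix.unitaryGroup (Fin (n + 1)) ℂ) : CP n → CP n :=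
  Projectivization.map A.1.mulVecLin (mulVec_injective A)

theorem mulVec_ne_zero (A : Matrix.unitaryGroup (Fin (n + 1)) ℂ) {z : Fin (n + 1) → ℂ}
    (hz : z ≠ 0) : A.1 *ᵥ z ≠ 0 := fun h =>
  hz (mulVec_injective A (by simpa using h))

theorem unitaryMap_mk (A : Matrix.unitaryGroup (Fin (n + 1)) ℂ) (z : Fin (n + 1) → ℂ)
    (hz : z ≠ 0) : unitaryMap A (Projectivization.mk ℂ z hz) =
      Projectivization.mk ℂ (A.1 *ᵥ z) (mulVec_ne_zero A hz) := rfl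

theorem unitaryMap_one : unitaryMap (1 : Matrix.unitaryGroup (Fin (n + 1)) ℂ) = id := by
  funext p
  induction p using Projectivization.ind with | h z hz =>
  simp [unitaryMap_mk]

theorem unitaryMap_mul (A B : Matrix.unitaryGroup (Fin (n + 1)) ℂ) (p : CP n) :
    unitaryMap (A * B) p = unitaryMap A (unitaryMap B p) := by
  induction p using Projectivization.ind with | h z hz =>
  simp [unitaryMap_mk, Matrix.mulVec_mulVec]

theorem continuous_unitaryMap (A : Matrix.unitaryGroup (Fin (n + 1)) ℂ) :
    Continuous (unitaryMap A) := by
  rw [isQuotientMap_mk'.continuous_iff]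
  refine isQuotientMap_mk'.continuous.comp (f := fun v : {v : Fin (n + 1) → ℂ // v ≠ 0} =>
    (⟨A.1 *ᵥ v.1, mulVec_ne_zero A v.2⟩ : {v : Fin (n + 1) → ℂ // v ≠ 0})) ?_
  exact (continuous_const.matrix_mulVec continuous_subtype_val).subtype_mk _

/-- The map `unitaryMap A` read in affine charts. -/
theorem unitaryMap_chart (A : Matrix.unitaryGroup (Fin (n + 1)) ℂ) (i j : Fin (n + 1)) :
    affineChart j ∘ unitaryMap A ∘ (affineChart i).symm =
      affCoord j ∘ (fun x => A.1 *ᵥ (i.insertNth (1 : ℂ) x : Fin (n + 1) → ℂ)) := rfl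

/-- The local representative of `unitaryMap A`, as a function of the matrix and the point. -/
def locRep (i j : Fin (n + 1)) (q : (Fin (n + 1) → Fin (n + 1) → ℂ) × (Fin n → ℂ)) :
    Fin n → ℂ :=
  affCoord j (Matrix.of q.1 *ᵥ (i.insertNth (1 : ℂ) q.2 : Fin (n + 1) → ℂ))

theorem contDiff_mulVec_insertNth (i : Fin (n + 1)) :
    ContDiff ℝ ∞ fun q : (Fin (n + 1) → Fin (n + 1) → ℂ) × (Fin n → ℂ) =>
      Matrix.of q.1 *ᵥ (i.insertNth (1 : ℂ) q.2 : Fin (n + 1) → ℂ) := by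
  refine contDiff_pi.2 fun m => ?_
  simp only [Matrix.mulVec, dotProduct, Matrix.of_apply]
  refine ContDiff.sum fun l _ => ContDiff.mul ?_ ?_
  · fun_prop
  · exact (contDiff_pi.1 (contDiff_insertNth i 1) l).comp contDiff_snd

theorem contDiffAt_locRep (i j : Fin (n + 1))
    {q : (Fin (n + 1) → Fin (n + 1) → ℂ) × (Fin n → ℂ)}
    (hq : (Matrix.of q.1 *ᵥ (i.insertNth (1 : ℂ) q.2 : Fin (n + 1) → ℂ)) j ≠ 0) :
    ContDiffAt ℝ ∞ (locRep i j) q :=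
  (contDiffAt_affCoord j hq).comp q (contDiff_mulVec_insertNth i).contDiffAt

theorem mulVec_affineChart_ne_zero (A : Matrix.unitaryGroup (Fin (n + 1)) ℂ) {i j : Fin (n + 1)}
    {p : CP n} (hi : p ∈ (affineChart i).source) :
    unitaryMap A p ∈ (affineChart j).source ↔
    (A.1 *ᵥ (i.insertNth (1 : ℂ) (affineChart i p) : Fin (n + 1) → ℂ)) j ≠ 0 := by
  conv_lhs => rw [← (affineChart i).left_inv hi]
  rw [affineChart_symm, unitaryMap_mk, mk_mem_source]

theorem contMDiff_unitaryMap (A : Matrix.unitaryGroup (Fin (n + 1)) ℂ) :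
    ContMDiff 𝓘(ℝ, Fin n → ℂ) 𝓘(ℝ, Fin n → ℂ) ∞ (unitaryMap A) := by
  intro p
  rw [contMDiffAt_iff]
  refine ⟨(continuous_unitaryMap A).continuousAt, ContDiffAt.contDiffWithinAt ?_⟩
  have h := (mulVec_affineChart_ne_zero A (i := p.idx) (rep_idx_ne_zero p)).1
    (rep_idx_ne_zero (unitaryMap A p))
  exact (contDiffAt_locRep p.idx (unitaryMap A p).idx (q := (A.1, affineChart p.idx p)) h).comp
    (affineChart p.idx p) (contDiffAt_const.prodMk contDiffAt_id)

/-- A unitary matrix acts on `ℂℙⁿ` by a diffeomorphism. -/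
def unitaryDiffeo (A : Matrix.unitaryGroup (Fin (n + 1)) ℂ) :
    CP n ≃ₘ⟮𝓘(ℝ, Fin n → ℂ), 𝓘(ℝ, Fin n → ℂ)⟯ CP n where
  toFun := unitaryMap A
  invFun := unitaryMap A⁻¹
  left_inv p := by rw [← unitaryMap_mul, inv_mul_cancel, unitaryMap_one]; rfl
  right_inv p := by rw [← unitaryMap_mul, mul_inv_cancel, unitaryMap_one]; rfl
  contMDiff_toFun := contMDiff_unitaryMap A
  contMDiff_invFun := contMDiff_unitaryMap A⁻¹

theorem mfderiv_unitaryMap (A : Matrix.unitaryGroup (Fin (n + 1)) ℂ) (p : CP n)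
    (u : Fin n → ℂ) :
    mfderiv 𝓘(ℝ, Fin n → ℂ) 𝓘(ℝ, Fin n → ℂ) (unitaryMap A) p u =
      fderiv ℝ (affCoord (unitaryMap A p).idx)
        (A.1 *ᵥ (p.idx.insertNth (1 : ℂ) (affineChart p.idx p) : Fin (n + 1) → ℂ))
        (A.1 *ᵥ (p.idx.insertNth (0 : ℂ) u : Fin (n + 1) → ℂ)) := by
  rw [((contMDiff_unitaryMap A).mdifferentiable (by simp) p).mfderiv]
  have h := (mulVec_affineChart_ne_zero A (i := p.idx) (rep_idx_ne_zero p)).1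
    (rep_idx_ne_zero (unitaryMap A p))
  have hd := ((contDiffAt_affCoord _ h).differentiableAt (by simp)).hasFDerivAt
  have hx : HasFDerivAt (fun x : Fin n → ℂ =>
      A.1 *ᵥ (p.idx.insertNth (1 : ℂ) x : Fin (n + 1) → ℂ))
      (LinearMap.toContinuousLinearMap ((A.1.mulVecLin.restrictScalars ℝ) ∘ₗ
        ({ toFun := fun x => p.idx.insertNth (0 : ℂ) x
           map_add' := fun x y => by
            ext m
            rcases Fin.eq_self_or_eq_succAbove p.idx m with h | ⟨k, h⟩ <;> rw [h] <;> simp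
           map_smul' := fun c x => by
            ext m
            rcases Fin.eq_self_or_eq_succAbove p.idx m with h | ⟨k, h⟩ <;> rw [h] <;> simp } :
          (Fin n → ℂ) →ₗ[ℝ] (Fin (n + 1) → ℂ)))) (affineChart p.idx p) := by
    refine HasFDerivAt.congr_of_eventuallyEq (f := fun x => A.1 *ᵥ (p.idx.insertNth (1 : ℂ) 0) +
      (LinearMap.toContinuousLinearMap _) x) ((ContinuousLinearMap.hasFDerivAt _).const_add _) ?_
    refine Filter.Eventually.of_forall fun x => ?_
    simp only [LinearMap.coe_toContinuousLinearMap', LinearMap.comp_apply, LinearMap.coe_mk,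
      AddHom.coe_mk, LinearMap.restrictScalars_apply, Matrix.mulVecLin_apply]
    rw [← Matrix.mulVec_add]
    congr 1
    ext m
    rcases Fin.eq_self_or_eq_succAbove p.idx m with h | ⟨k, h⟩ <;> rw [h] <;> simp
  have hcomp := hd.comp (f := fun x : Fin n → ℂ =>
    A.1 *ᵥ (p.idx.insertNth (1 : ℂ) x : Fin (n + 1) → ℂ)) (affineChart p.idx p) hx
  have : fderivWithin ℝ (writtenInExtChartAt 𝓘(ℝ, Fin n → ℂ) 𝓘(ℝ, Fin n → ℂ) p (unitaryMap A))
      (range 𝓘(ℝ, Fin n → ℂ)) (extChartAt 𝓘(ℝ, Fin n → ℂ) p p) =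
      fderiv ℝ (affCoord (unitaryMap A p).idx ∘ fun x : Fin n → ℂ =>
        A.1 *ᵥ (p.idx.insertNth (1 : ℂ) x : Fin (n + 1) → ℂ)) (affineChart p.idx p) := by
    rw [modelWithCornersSelf_coe, range_id, fderivWithin_univ]
    rfl
  rw [this, hcomp.fderiv]
  rfl

theorem fsForm_unitary (A : Matrix.unitaryGroup (Fin (n + 1)) ℂ) (z a b : Fin (n + 1) → ℂ) :
    fsForm (A.1 *ᵥ z) (A.1 *ᵥ a) (A.1 *ᵥ b) = fsForm z a b := by
  have h : ∀ v w, star (A.1 *ᵥ v) ⬝ᵥ (A.1 *ᵥ w) = star v ⬝ᵥ w := fun v w => by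
    rw [Matrix.star_mulVec, ← Matrix.dotProduct_mulVec, Matrix.mulVec_mulVec,
      ← Matrix.star_eq_conjTranspose, Matrix.UnitaryGroup.star_mul_self, Matrix.one_mulVec]
  simp only [fsForm, h]

theorem unitaryDiffeo_mem_symp (A : Matrix.unitaryGroup (Fin (n + 1)) ℂ) :
    unitaryDiffeo A ∈ Symp (fubiniStudy (n := n)) := by
  intro p u v
  have h := (mulVec_affineChart_ne_zero A (i := p.idx) (rep_idx_ne_zero p)).1
    (rep_idx_ne_zero (unitaryMap A p))
  have hc : affineChart (unitaryMap A p).idx (unitaryMap A p) =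
      affCoord (unitaryMap A p).idx
        (A.1 *ᵥ (p.idx.insertNth (1 : ℂ) (affineChart p.idx p) : Fin (n + 1) → ℂ)) := by
    have := congrFun (unitaryMap_chart A p.idx (unitaryMap A p).idx) (affineChart p.idx p)
    simpa only [Function.comp_apply, (affineChart p.idx).left_inv (rep_idx_ne_zero p)] using this
  have key := congrArg₂ (fun a b : Fin n → ℂ =>
      fsForm ((unitaryMap A p).idx.insertNth (1 : ℂ)
        (affineChart (unitaryMap A p).idx (unitaryMap A p)))
      ((unitaryMap A p).idx.insertNth (0 : ℂ) a) ((unitaryMap A p).idx.insertNth (0 : ℂ) b))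
    (mfderiv_unitaryMap A p u) (mfderiv_unitaryMap A p v)
  refine key.trans ?_
  rw [hc, fsForm_affCoord _ h, fsForm_unitary]
  rfl

end CP

/-! ### The projective unitary group and its inclusion -/

/-- The scalar matrices in `U(m)`. -/
def scalarUnitary (m : ℕ) : Subgroup (Matrix.unitaryGroup (Fin m) ℂ) where
  carrier := {A | ∃ c : ℂ, A.1 = c • (1 : Matrix (Fin m) (Fin m) ℂ)}
  one_mem' := ⟨1, by simp⟩
  mul_mem' := by
    rintro A B ⟨c, hc⟩ ⟨d, hd⟩
    exact ⟨c * d, by simp [hc, hd, smul_smul, mul_comm]⟩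
  inv_mem' := by
    rintro A ⟨c, hc⟩
    exact ⟨star c, by
      rw [Matrix.UnitaryGroup.inv_val, hc, star_smul, star_one]⟩

instance (m : ℕ) : (scalarUnitary m).Normal where
  conj_mem := by
    rintro A ⟨c, hc⟩ B
    refine ⟨c, ?_⟩
    rw [Matrix.UnitaryGroup.mul_val, Matrix.UnitaryGroup.mul_val, hc]
    rw [Matrix.mul_smul, Matrix.mul_one, Matrix.smul_mul, ← Matrix.UnitaryGroup.mul_val,
      mul_inv_cancel, Matrix.UnitaryGroup.one_val]

/-- The projective unitary group `PU(m) = U(m) / U(1)`, with the quotient topology. -/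
def PU (m : ℕ) : Type := Matrix.unitaryGroup (Fin m) ℂ ⧸ scalarUnitary m

instance (m : ℕ) : Group (PU m) :=
  inferInstanceAs (Group (Matrix.unitaryGroup (Fin m) ℂ ⧸ scalarUnitary m))

instance (m : ℕ) : TopologicalSpace (PU m) :=
  inferInstanceAs (TopologicalSpace (Matrix.unitaryGroup (Fin m) ℂ ⧸ scalarUnitary m))

namespace CP

variable {n : ℕ}

/-- The action of `U(n+1)` on `(ℂℙⁿ, ω_FS)` by symplectomorphisms. -/
def unitaryHom (n : ℕ) : Matrix.unitaryGroup (Fin (n + 1)) ℂ →* Symp (fubiniStudy (n := n)) where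
  toFun A := ⟨unitaryDiffeo A, unitaryDiffeo_mem_symp A⟩
  map_one' := Subtype.ext (Diffeomorph.ext fun p => congrFun unitaryMap_one p)
  map_mul' A B := Subtype.ext (Diffeomorph.ext fun p => unitaryMap_mul A B p)

theorem scalar_le_ker (n : ℕ) : scalarUnitary (n + 1) ≤ (unitaryHom n).ker := by
  rintro A ⟨c, hc⟩
  refine Subtype.ext (Diffeomorph.ext fun p => ?_)
  change unitaryMap A p = p
  induction p using Projectivization.ind with | h z hz =>
  rw [unitaryMap_mk, Projectivization.mk_eq_mk_iff']
  exact ⟨c, by rw [hc, Matrix.smul_mulVec, Matrix.one_mulVec]⟩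

/-- The inclusion `ι : PU(n+1) → Symp(ℂℙⁿ, ω_FS)`, `[A] ↦ ([z] ↦ [A z])`. -/
def puHom (n : ℕ) : PU (n + 1) →* Symp (fubiniStudy (n := n)) :=
  QuotientGroup.lift (scalarUnitary (n + 1)) (unitaryHom n) (scalar_le_ker n)

theorem contDiffAt_iteratedFDeriv_right {P F G : Type*} [NormedAddCommGroup P] [NormedSpace ℝ P]
    [NormedAddCommGroup F] [NormedSpace ℝ F] [NormedAddCommGroup G] [NormedSpace ℝ G]
    {D : P × F → G} {q : P × F} (hD : ContDiffAt ℝ ∞ D q) (m : ℕ) :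
    ContDiffAt ℝ ∞ (fun r : P × F => iteratedFDeriv ℝ m (fun x => D (r.1, x)) r.2) q := by
  induction m with
  | zero =>
    exact (continuousMultilinearCurryFin0 ℝ F G).symm.contDiff.contDiffAt.comp q hD
  | succ m ih =>
    have h1 : ContDiffAt ℝ ∞ (fun r : P × F =>
        fderiv ℝ (iteratedFDeriv ℝ m (fun x => D (r.1, x))) r.2) q := by
      refine ContDiffAt.fderiv (n := ∞)
        (f := fun (r : P × F) (x : F) => iteratedFDeriv ℝ m (fun x => D (r.1, x)) x)
        (g := Prod.snd) ?_ contDiffAt_snd (by simp)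
      exact ih.comp (q, q.2) (f := fun s : (P × F) × F => (s.1.1, s.2)) (by fun_prop)
    simp_rw [iteratedFDeriv_succ_eq_comp_left]
    exact (continuousMultilinearCurryLeftEquiv ℝ (fun _ : Fin (m + 1) => F) G).symm.contDiff.contDiffAt.comp
      q h1

/-- Joint continuity of all derivatives of the action, in arbitrary smooth charts. -/
theorem eventually_chart {c c' : OpenPartialHomeomorph (CP n) (Fin n → ℂ)}
    (hc : c ∈ IsManifold.maximalAtlas 𝓘(ℝ, Fin n → ℂ) ∞ (CP n))
    (hc' : c' ∈ IsManifold.maximalAtlas 𝓘(ℝ, Fin n → ℂ) ∞ (CP n))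
    (A : Matrix.unitaryGroup (Fin (n + 1)) ℂ) {x : Fin n → ℂ} (hx : x ∈ c.target)
    (hAx : unitaryMap A (c.symm x) ∈ c'.source) :
    (∀ᶠ r : Matrix.unitaryGroup (Fin (n + 1)) ℂ × (Fin n → ℂ) in 𝓝 (A, x),
      unitaryMap r.1 (c.symm r.2) ∈ c'.source) ∧
    ∀ m : ℕ, ContinuousAt (fun r : Matrix.unitaryGroup (Fin (n + 1)) ℂ × (Fin n → ℂ) =>
      iteratedFDeriv ℝ m (c' ∘ unitaryMap r.1 ∘ c.symm) r.2) (A, x) := by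
  set i := (c.symm x).idx with hi
  set j := (unitaryMap A (c.symm x)).idx with hj
  have hxi : c.symm x ∈ (affineChart i).source := rep_idx_ne_zero _
  have hyj : unitaryMap A (c.symm x) ∈ (affineChart j).source := rep_idx_ne_zero _
  let a : Fin (n + 1) → Fin (n + 1) → ℂ := A.1
  -- the change of coordinates from `c` to the affine chart
  have hg : ContDiffAt ℝ ∞ (affineChart i ∘ c.symm) x := by
    rw [← contMDiffAt_iff_contDiffAt]
    exact (contMDiffAt_of_mem_maximalAtlas
      (IsManifold.subset_maximalAtlas (mem_range_self i)) hxi).comp x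
        (contMDiffAt_symm_of_mem_maximalAtlas hc hx)
  let T : Type := (Fin (n + 1) → Fin (n + 1) → ℂ) × (Fin n → ℂ)
  let e : T → T := fun q => (q.1, affineChart i (c.symm q.2))
  have he : ContDiffAt ℝ ∞ e (a, x) :=
    contDiffAt_fst.prodMk (hg.comp (a, x) (f := Prod.snd) contDiffAt_snd)
  have hne := (mulVec_affineChart_ne_zero A hxi).1 hyj
  have hloc : ContDiffAt ℝ ∞ (fun q => locRep i j (e q)) ((a, x) : T) :=
    (contDiffAt_locRep i j (q := e (a, x)) hne).comp _ he
  have hval : (affineChart j).symm (locRep i j (e (a, x))) = unitaryMap A (c.symm x) := by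
    have := congrFun (unitaryMap_chart A i j) (affineChart i (c.symm x))
    simp only [Function.comp_apply, (affineChart i).left_inv hxi] at this
    rw [← (affineChart j).left_inv hyj, this]
    rfl
  have hh : ContDiffAt ℝ ∞ (c' ∘ (affineChart j).symm) (locRep i j (e (a, x))) := by
    rw [← contMDiffAt_iff_contDiffAt]
    refine ContMDiffAt.comp _ (contMDiffAt_of_mem_maximalAtlas hc' ?_)
      (contMDiffAt_symm_of_mem_maximalAtlas
        (IsManifold.subset_maximalAtlas (mem_range_self j)) (mem_univ _))
    rw [hval]; exact hAx
  have hD : ContDiffAt ℝ ∞ (fun q => (c' ∘ (affineChart j).symm) (locRep i j (e q)))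
      ((a, x) : T) := ContDiffAt.comp (f := fun q : T => locRep i j (e q)) (a, x) hh hloc
  -- the action is given by this formula near `(A, x)`
  have hsrc : ∀ᶠ q : T in 𝓝 (a, x), c.symm q.2 ∈ (affineChart i).source := by
    have : ContinuousAt (fun q : T => c.symm q.2) (a, x) :=
      (c.symm.continuousAt (x := x) hx).comp (f := Prod.snd) continuousAt_snd
    exact this.eventually ((affineChart i).open_source.mem_nhds hxi)
  have hden : ∀ᶠ q : T in 𝓝 (a, x),
      (Matrix.of q.1 *ᵥ (i.insertNth (1 : ℂ) (affineChart i (c.symm q.2)) : Fin (n + 1) → ℂ)) j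
        ≠ 0 := by
    have h1 : ContinuousAt (fun q : T => (Matrix.of (e q).1 *ᵥ
        (i.insertNth (1 : ℂ) (e q).2 : Fin (n + 1) → ℂ)) j) (a, x) :=
      ((continuous_apply j).comp (contDiff_mulVec_insertNth i).continuous).continuousAt.comp
        (f := e) he.continuousAt
    exact h1.eventually_ne hne
  have hform : ∀ᶠ q : T in 𝓝 (a, x), ∀ B : Matrix.unitaryGroup (Fin (n + 1)) ℂ, B.1 = q.1 →
      unitaryMap B (c.symm q.2) = (affineChart j).symm (locRep i j (e q)) := by
    filter_upwards [hsrc, hden] with q h1 h2 B hB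
    have hB2 : unitaryMap B (c.symm q.2) ∈ (affineChart j).source := by
      rw [mulVec_affineChart_ne_zero B h1, hB]; exact h2
    have := congrFun (unitaryMap_chart B i j) (affineChart i (c.symm q.2))
    simp only [Function.comp_apply, (affineChart i).left_inv h1] at this
    rw [← (affineChart j).left_inv hB2, this]
    simp only [locRep, e, ← hB]
    rfl
  let ρ : Matrix.unitaryGroup (Fin (n + 1)) ℂ × (Fin n → ℂ) → T := fun r => (r.1.1, r.2)
  have hρ : Continuous ρ := (continuous_subtype_val.comp continuous_fst).prodMk continuous_snd
  have hρA : Filter.Tendsto ρ (𝓝 (A, x)) (𝓝 (a, x)) := hρ.tendsto (A, x)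
  refine ⟨?_, fun m => ?_⟩
  · have h1 : ContinuousAt (fun q : T => (affineChart j).symm (locRep i j (e q))) (a, x) :=
      ((affineChart j).symm.continuousAt (mem_univ _)).comp hloc.continuousAt
    have h2 : ∀ᶠ q : T in 𝓝 (a, x), (affineChart j).symm (locRep i j (e q)) ∈ c'.source := by
      refine h1.eventually (c'.open_source.mem_nhds ?_)
      change (affineChart j).symm (locRep i j (e (a, x))) ∈ c'.source
      rw [hval]; exact hAx
    filter_upwards [hρA.eventually h2, hρA.eventually hform] with r h3 h4
    rw [h4 r.1 rfl]; exact h3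
  · have h1 := (contDiffAt_iteratedFDeriv_right (P := Fin (n + 1) → Fin (n + 1) → ℂ) hD m).continuousAt
    have h2 := ContinuousAt.comp (f := ρ) (x := (A, x)) h1 hρ.continuousAt
    refine h2.congr ?_
    filter_upwards [hρA.eventually hform.eventually_nhds] with r hr
    refine Filter.EventuallyEq.eq_of_nhds (f := iteratedFDeriv ℝ m _)
      (Filter.EventuallyEq.iteratedFDeriv ℝ ?_ m)
    have hins : Filter.Tendsto (fun y : Fin n → ℂ => ((r.1.1, y) : T)) (𝓝 r.2) (𝓝 (ρ r)) :=
      (Continuous.prodMk_right r.1.1).tendsto r.2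
    filter_upwards [hins.eventually hr] with y hy
    simp only [Function.comp_apply, hy r.1 rfl]
    rfl

theorem continuous_unitaryDiffeo : Continuous (unitaryDiffeo (n := n)) := by
  refine continuous_generateFrom_iff.2 ?_
  rintro _ ⟨f, c, c', K, k, ε, hc, hc', hK, hKc, hf, hε, rfl⟩
  rw [isOpen_iff_eventually]
  rintro A ⟨hA1, hA2⟩
  have hA1' : ∀ x ∈ K, unitaryMap A (c.symm x) ∈ c'.source := fun x hx =>
    hA1 (mem_image_of_mem _ hx)
  have h1 : ∀ᶠ B in 𝓝 A, ∀ x ∈ K, unitaryMap B (c.symm x) ∈ c'.source :=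
    hK.eventually_forall_of_forall_eventually fun x hx =>
      (eventually_chart hc hc' A (hKc hx) (hA1' x hx)).1
  have h2 : ∀ᶠ B in 𝓝 A, ∀ i ∈ Iic k, ∀ x ∈ K,
      ‖iteratedFDeriv ℝ i (c' ∘ unitaryMap B ∘ c.symm) x -
        iteratedFDeriv ℝ i (c' ∘ f ∘ c.symm) x‖ < ε := by
    refine (Filter.eventually_all_finite (finite_Iic k)).2 fun i hi => ?_
    refine hK.eventually_forall_of_forall_eventually (P := fun B x =>
      ‖iteratedFDeriv ℝ i (c' ∘ unitaryMap B ∘ c.symm) x -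
        iteratedFDeriv ℝ i (c' ∘ f ∘ c.symm) x‖ < ε) fun x hx => ?_
    have h3 := (eventually_chart hc hc' A (hKc hx) (hA1' x hx)).2 i
    have h4 : ContDiffAt ℝ ∞ (c' ∘ f ∘ c.symm) x := by
      rw [← contMDiffAt_iff_contDiffAt]
      exact (contMDiffAt_of_mem_maximalAtlas hc' (hf (mem_image_of_mem _ hx))).comp x
        (f.contMDiff.contMDiffAt.comp x (contMDiffAt_symm_of_mem_maximalAtlas hc (hKc hx)))
    have h5 : ContinuousAt (iteratedFDeriv ℝ i (c' ∘ f ∘ c.symm)) x :=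
      (h4.iteratedFDeriv_right (m := 0) (i := i)
        (by rw [zero_add]; exact_mod_cast le_top)).continuousAt
    exact (h3.sub (h5.comp (f := Prod.snd) (x := (A, x)) continuousAt_snd)).norm.eventually_lt
      continuousAt_const (hA2 i hi x hx)
  filter_upwards [h1, h2] with B h3 h4
  exact ⟨by rintro _ ⟨x, hx, rfl⟩; exact h3 x hx, h4⟩

/-- The inclusion `ι : PU(n+1) → Symp(ℂℙⁿ, ω_FS)` is continuous. -/
theorem continuous_puHom (n : ℕ) : Continuous (puHom n) := by
  refine Topology.IsQuotientMap.continuous_iff (QuotientGroup.isQuotientMap_mk (scalarUnitary (n + 1))) |>.2 ?_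
  exact continuous_unitaryDiffeo.subtype_mk _

/-- The inclusion `ι : PU(n+1) → Symp(ℂℙⁿ, ω_FS)` as a continuous map. -/
def puMap (n : ℕ) : C(PU (n + 1), Symp (fubiniStudy (n := n))) :=
  ⟨puHom n, continuous_puHom n⟩

end CP

end

/-!
The inclusion of `PU(n+1)` into the symplectomorphism group of `ℂℙⁿ` has a continuous left inverse
(`CP.retraction`), so it is injective on homotopy groups in every degree.

Geometrically, `PU(n+1)` acts simply transitively on the unitary frames of `ℂℙⁿ`, while a
symplectomorphism `φ` sends the standard unitary frame at `[1 : 0 : … : 0]` to a symplectic frame at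
`φ [1 : 0 : … : 0]`; symplectic frames retract onto unitary frames. Concretely, the complex-linear
part `α` of the differential `D` of `φ` is injective (`CP.complexPart_injective`): if `α u = 0`,
then `D (i u) = - i D u`, so that `ω (u, i u) = ω (D u, D (i u)) = - ω (D u, i D u) ≤ 0`, and
`u = 0`. Hence a vector `z` spanning the line `φ [1 : 0 : … : 0]`, together with lifts to `ℂⁿ⁺¹` of
the vectors `α eₖ`, is a frame of `ℂⁿ⁺¹`, and the Gram–Schmidt process turns it into a unitary
matrix. Another choice of `z` and of the lifts, or of the affine chart in which they are computed,
multiplies all vectors of the frame by one scalar and adds multiples of `z` to the later ones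
(`CP.exists_frame_eq`); the class of the matrix in `PU(n+1)` does not change
(`PU.ofFrame_smul_add`). For `φ = [A]` the columns of `A` are such a frame, so the class is `[A]`
(`CP.retraction_unitaryHom`). The construction is continuous because it involves only the value
and the first derivative of `φ` at one point (`CP.continuousAt_frame`) and because the Gram–Schmidt
process is continuous on linearly independent families.
-/

/-! ### Gram–Schmidt -/

namespace InnerProductSpace

variable {V : Type*} [NormedAddCommGroup V] [InnerProductSpace ℂ V]

/-- The Gram–Schmidt process depends continuously on the family as long as it does not
degenerate. -/
theorem continuousAt_gramSchmidt {X : Type*} [TopologicalSpace X] {m : ℕ} {F : X → Fin m → V}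
    {x : X} (hF : ContinuousAt F x) (hx : LinearIndependent ℂ (F x)) (k : Fin m) :
    ContinuousAt (fun y => gramSchmidt ℂ (F y) k) x := by
  induction k using WellFoundedLT.induction with | ind k ih =>
  have hFk : ContinuousAt (fun y => F y k) x := (continuous_apply k).continuousAt.comp hF
  simp_rw [gramSchmidt_def ℂ _ k, Submodule.starProjection_singleton]
  refine hFk.sub (tendsto_finsetSum _ fun i hi => ?_)
  have hi := ih i (Finset.mem_Iio.1 hi)
  refine ContinuousAt.smul (ContinuousAt.div₀ (Filter.Tendsto.inner hi hFk) ?_ ?_) hi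
  · exact Complex.continuous_ofReal.continuousAt.comp (hi.norm.pow 2)
  · simpa using gramSchmidt_ne_zero (𝕜 := ℂ) i hx

/-- Rescaling all vectors of a family by `c` and adding multiples of the first vector to the later
ones multiplies the output of the Gram–Schmidt process by `c`. -/
theorem gramSchmidt_smul_add {n : ℕ} {f g : Fin (n + 1) → V} {c : ℂ} (hc : c ≠ 0)
    {s : Fin (n + 1) → ℂ} (hs : s 0 = 0) (h : ∀ k, g k = c • f k + s k • f 0) (k : Fin (n + 1)) :
    gramSchmidt ℂ g k = c • gramSchmidt ℂ f k := by
  induction k using WellFoundedLT.induction with | ind k ih =>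
  have hspan : ∀ i ∈ Finset.Iio k, (ℂ ∙ gramSchmidt ℂ g i).starProjection (g k) =
      c • (ℂ ∙ gramSchmidt ℂ f i).starProjection (f k) +
        s k • (ℂ ∙ gramSchmidt ℂ f i).starProjection (f 0) := fun i hi => by
    have : (ℂ ∙ gramSchmidt ℂ g i) = ℂ ∙ gramSchmidt ℂ f i := by
      rw [ih i (Finset.mem_Iio.1 hi)]
      exact Submodule.span_singleton_smul_eq (IsUnit.mk0 c hc) _
    simp only [this, h k, map_add, map_smul]
  rw [gramSchmidt_def ℂ g, gramSchmidt_def ℂ f k, Finset.sum_congr rfl hspan,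
    Finset.sum_add_distrib, ← Finset.smul_sum, ← Finset.smul_sum, h k]
  rcases eq_or_ne k 0 with rfl | hk
  · rw [hs, zero_smul, zero_smul, add_zero, add_zero, smul_sub]
  have h0 : gramSchmidt ℂ f 0 = f 0 := gramSchmidt_bot ℂ f
  have hsum : ∑ i ∈ Finset.Iio k, (ℂ ∙ gramSchmidt ℂ f i).starProjection (f 0) = f 0 := by
    rw [Finset.sum_eq_single_of_mem 0 (Finset.mem_Iio.2 (Fin.pos_iff_ne_zero.2 hk))]
    · rw [h0, Submodule.starProjection_eq_self_iff]
      exact Submodule.mem_span_singleton_self _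
    · intro i _ hi
      rw [Submodule.starProjection_singleton, ← h0, gramSchmidt_orthogonal ℂ f hi]
      simp
  rw [hsum, smul_sub]
  abel

end InnerProductSpace

/-! ### From frames of `ℂⁿ⁺¹` to the projective unitary group -/

namespace PU

open InnerProductSpace

variable {m n : ℕ}

/-- The unitary matrix whose columns are obtained from the family `f` of vectors of `ℂᵐ` by the
Gram–Schmidt process. If `f` is linearly dependent, the columns are completed arbitrarily. -/
noncomputable def unitarize (f : Fin m → Fin m → ℂ) : Matrix.unitaryGroup (Fin m) ℂ :=
  ⟨Matrix.of fun i k => gramSchmidtOrthonormalBasis (𝕜 := ℂ) (E := EuclideanSpace ℂ (Fin m))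
      (by simp) (fun k => WithLp.toLp 2 (f k)) k i, by
    rw [Matrix.mem_unitaryGroup_iff']
    ext k l
    have := orthonormal_iff_ite.1 (gramSchmidtOrthonormalBasis (𝕜 := ℂ)
      (E := EuclideanSpace ℂ (Fin m)) (by simp) (fun k => WithLp.toLp 2 (f k))).orthonormal k l
    rw [Matrix.one_apply, ← this]
    simp [Matrix.mul_apply, PiLp.inner_apply, mul_comm]⟩

theorem linearIndependent_toLp {f : Fin m → Fin m → ℂ} (hf : LinearIndependent ℂ f) :
    LinearIndependent ℂ fun k => (WithLp.toLp 2 (f k) : EuclideanSpace ℂ (Fin m)) :=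
  hf.map' (WithLp.linearEquiv 2 ℂ (Fin m → ℂ)).symm.toLinearMap (LinearEquiv.ker _)

theorem unitarize_apply {f : Fin m → Fin m → ℂ} (hf : LinearIndependent ℂ f) (i k : Fin m) :
    (unitarize f).1 i k = gramSchmidtNormed ℂ
      (fun k => (WithLp.toLp 2 (f k) : EuclideanSpace ℂ (Fin m))) k i := by
  have h := (gramSchmidtNormed_unit_length k (linearIndependent_toLp hf))
  exact congrArg (fun v : EuclideanSpace ℂ (Fin m) => v i)
    (gramSchmidtOrthonormalBasis_apply (by simp) (norm_ne_zero_iff.1 (h ▸ one_ne_zero)))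

theorem continuousAt_unitarize {X : Type*} [TopologicalSpace X] {F : X → Fin m → Fin m → ℂ} {x : X}
    (hF : ContinuousAt F x) (hx : ∀ᶠ y in 𝓝 x, LinearIndependent ℂ (F y)) :
    ContinuousAt (fun y => unitarize (F y)) x := by
  refine Topology.IsInducing.subtypeVal.continuousAt_iff.2 ?_
  refine continuousAt_pi.2 fun i => continuousAt_pi.2 fun k => ?_
  have hE : ContinuousAt (fun y k => (WithLp.toLp 2 (F y k) : EuclideanSpace ℂ (Fin m))) x :=
    continuousAt_pi.2 fun k => (PiLp.continuous_toLp 2 fun _ : Fin m => ℂ).continuousAt.comp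
      ((continuous_apply k).continuousAt.comp hF)
  have hli := linearIndependent_toLp hx.self_of_nhds
  have hgs := continuousAt_gramSchmidt hE hli k
  have hcont : ContinuousAt (fun y => gramSchmidtNormed ℂ
      (fun k => (WithLp.toLp 2 (F y k) : EuclideanSpace ℂ (Fin m))) k i) x := by
    have hn : ContinuousAt (fun y => ((‖gramSchmidt ℂ (fun k => (WithLp.toLp 2 (F y k) :
        EuclideanSpace ℂ (Fin m))) k‖ : ℝ) : ℂ)) x :=
      Complex.continuous_ofReal.continuousAt.comp hgs.norm
    exact (hn.inv₀ (by simpa using gramSchmidt_ne_zero (𝕜 := ℂ) k hli)).mul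
      ((EuclideanSpace.proj (𝕜 := ℂ) i).continuous.continuousAt.comp hgs)
  refine hcont.congr ?_
  filter_upwards [hx] with y hy
  exact (unitarize_apply hy i k).symm

/-- The columns of a unitary matrix are their own Gram–Schmidt orthonormalization. -/
theorem unitarize_col (A : Matrix.unitaryGroup (Fin m) ℂ) : unitarize A.1.col = A := by
  have hA : Orthonormal ℂ fun k => (WithLp.toLp 2 (A.1.col k) : EuclideanSpace ℂ (Fin m)) := by
    rw [orthonormal_iff_ite]
    intro k l
    rw [← Matrix.one_apply, ← Matrix.UnitaryGroup.star_mul_self A]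
    simp [Matrix.mul_apply, PiLp.inner_apply, mul_comm]
  ext i k
  have h := gramSchmidtOrthonormalBasis_apply_of_orthogonal (𝕜 := ℂ) (by simp)
    (fun _ _ h => hA.2 h) (hA.ne_zero k)
  rw [hA.1 k, RCLike.ofReal_one, inv_one, one_smul] at h
  exact congrArg (fun v : EuclideanSpace ℂ (Fin m) => v i) h

theorem linearIndependent_smul_add {f g : Fin (n + 1) → Fin (n + 1) → ℂ}
    (hf : LinearIndependent ℂ f) {c : ℂ} (hc : c ≠ 0) {s : Fin (n + 1) → ℂ} (hs : s 0 = 0)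
    (h : ∀ k, g k = c • f k + s k • f 0) : LinearIndependent ℂ g := by
  rw [Fintype.linearIndependent_iff] at hf ⊢
  intro a ha
  have hcoef := hf (fun k => c * a k + if k = 0 then ∑ l, a l * s l else 0) <| by
    rw [← ha]
    simp only [h, add_smul, smul_add, Finset.sum_add_distrib, ite_smul, zero_smul,
      Finset.sum_ite_eq', Finset.mem_univ, if_true, Finset.sum_smul, smul_smul, mul_comm c]
  have hsucc : ∀ k ≠ 0, a k = 0 := fun k hk => by simpa [hk, hc] using hcoef k
  have hzero : a 0 = 0 := by
    have hsum : ∑ l, a l * s l = 0 := Finset.sum_eq_zero fun l _ => by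
      rcases eq_or_ne l 0 with rfl | hl
      · rw [hs, mul_zero]
      · rw [hsucc l hl, zero_mul]
    simpa [hsum, hc] using hcoef 0
  intro k
  rcases eq_or_ne k 0 with rfl | hk
  exacts [hzero, hsucc k hk]

/-- The class in `PU(m)` of the unitary matrix obtained from the frame `f`. -/
noncomputable def ofFrame (f : Fin m → Fin m → ℂ) : PU m :=
  QuotientGroup.mk (s := scalarUnitary m) (unitarize f)

/-- The class in `PU(n+1)` only depends on the line spanned by the first vector of the frame and
on the later vectors modulo this line, up to a common factor. -/
theorem ofFrame_smul_add {f g : Fin (n + 1) → Fin (n + 1) → ℂ} (hf : LinearIndependent ℂ f)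
    {c : ℂ} (hc : c ≠ 0) {s : Fin (n + 1) → ℂ} (hs : s 0 = 0)
    (h : ∀ k, g k = c • f k + s k • f 0) : ofFrame g = ofFrame f := by
  have hg := linearIndependent_smul_add hf hc hs h
  have key : (unitarize g).1 = (c / ‖c‖) • (unitarize f).1 := by
    ext i k
    have hgs := gramSchmidt_smul_add (V := EuclideanSpace ℂ (Fin (n + 1)))
      (f := fun k => WithLp.toLp 2 (f k)) (g := fun k => WithLp.toLp 2 (g k)) hc hs
      (fun k => by rw [h k]; rfl) k
    rw [Matrix.smul_apply, unitarize_apply hf, unitarize_apply hg, gramSchmidtNormed,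
      gramSchmidtNormed, hgs, norm_smul]
    simp only [PiLp.smul_apply, smul_eq_mul, RCLike.ofReal_mul, Complex.coe_algebraMap]
    change ((‖c‖ : ℂ) * _)⁻¹ * _ = _
    ring
  refine (QuotientGroup.eq (s := scalarUnitary (n + 1))).2 ⟨star (c / ‖c‖), ?_⟩
  rw [Matrix.UnitaryGroup.mul_val, Matrix.UnitaryGroup.inv_val, key, star_smul, Matrix.smul_mul,
    Matrix.UnitaryGroup.star_mul_self]

end PU

/-! ### The complex-linear part of a real-linear map -/

section ComplexPart

variable {V W : Type*} [AddCommGroup V] [Module ℂ V] [AddCommGroup W] [Module ℂ W]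

/-- The complex-linear part `u ↦ (D u - i D (i u)) / 2` of a real-linear map `D` between complex
vector spaces. -/
noncomputable def complexPart (D : V →ₗ[ℝ] W) : V →ₗ[ℂ] W where
  toFun u := (2 : ℂ)⁻¹ • (D u - Complex.I • D (Complex.I • u))
  map_add' u v := by
    simp only [smul_add, map_add]
    module
  map_smul' c u := by
    have h : ∀ c : ℂ, ∀ u : V, D (c • u) = (c.re : ℂ) • D u + (c.im : ℂ) • D (Complex.I • u) := by
      intro c u
      have : c • u = c.re • u + c.im • Complex.I • u := by
        rw [← Complex.coe_smul, ← Complex.coe_smul, smul_smul, ← add_smul, Complex.re_add_im]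
      rw [this, map_add, map_smul, map_smul, Complex.coe_smul, Complex.coe_smul]
    have h2 : D (Complex.I • c • u) = (c.re : ℂ) • D (Complex.I • u) - (c.im : ℂ) • D u := by
      rw [smul_smul, h]
      simp [sub_eq_neg_add]
    rw [h2, h c u]
    obtain ⟨a, b⟩ := c
    have hc : (⟨a, b⟩ : ℂ) = a + b * Complex.I := Complex.mk_eq_add_mul_I a b
    simp only [hc, RingHom.id_apply]
    match_scalars
    · simp; ring
    · simp; linear_combination (b / 2 : ℂ) * Complex.I_sq

theorem complexPart_apply (D : V →ₗ[ℝ] W) (u : V) :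
    complexPart D u = (2 : ℂ)⁻¹ • (D u - Complex.I • D (Complex.I • u)) := rfl

theorem complexPart_of_commute {D : V →ₗ[ℝ] W}
    (hD : ∀ u, D (Complex.I • u) = Complex.I • D u) (u : V) : complexPart D u = D u := by
  rw [complexPart_apply, hD, smul_smul, Complex.I_mul_I]
  module

/-- If the complex-linear part of `D` vanishes at `u`, then `D` is antilinear on the complex line
through `u`. -/
theorem apply_I_smul_of_complexPart_eq_zero {D : V →ₗ[ℝ] W} {u : V} (h : complexPart D u = 0) :
    D (Complex.I • u) = -(Complex.I • D u) := by
  rw [complexPart_apply, smul_eq_zero_iff_right (by norm_num), sub_eq_zero] at h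
  rw [h, smul_smul, Complex.I_mul_I]
  module

end ComplexPart

namespace CP

variable {n : ℕ}

/-! ### Positivity of the Fubini–Study form -/

open scoped ComplexOrder in
theorem fsForm_smul_I_nonneg (z a : Fin (n + 1) → ℂ) : 0 ≤ fsForm z a (Complex.I • a) := by
  refine div_nonneg ?_ (sq_nonneg _)
  have hcs : ‖star z ⬝ᵥ a‖ * ‖star a ⬝ᵥ z‖ ≤ (star z ⬝ᵥ z).re * (star a ⬝ᵥ a).re := by
    have := inner_mul_inner_self_le (𝕜 := ℂ)
      (WithLp.toLp 2 z : EuclideanSpace ℂ (Fin (n + 1))) (WithLp.toLp 2 a)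
    simpa only [EuclideanSpace.inner_toLp_toLp, dotProduct_comm _ (star _),
      RCLike.re_eq_complex_re] using this
  have hz : (star z ⬝ᵥ z).im = 0 := (Complex.nonneg_iff.1 (dotProduct_star_self_nonneg z)).2.symm
  have ha : (star a ⬝ᵥ a).im = 0 := (Complex.nonneg_iff.1 (dotProduct_star_self_nonneg a)).2.symm
  have hre := (Complex.re_le_norm _).trans ((norm_mul _ _).trans_le hcs)
  simp only [dotProduct_smul, smul_eq_mul, Complex.sub_im, Complex.mul_im, Complex.mul_re,
    Complex.I_re, Complex.I_im, hz, ha] at hre ⊢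
  linarith

theorem fsForm_neg_right (z a b : Fin (n + 1) → ℂ) : fsForm z a (-b) = -fsForm z a b := by
  simp only [fsForm, dotProduct_neg, mul_neg, neg_mul, Complex.sub_im, Complex.neg_im]
  ring

open scoped ComplexOrder in
theorem fsForm_base_pos {u : Fin n → ℂ} (hu : u ≠ 0) :
    0 < fsForm ((0 : Fin (n + 1)).insertNth (1 : ℂ) (0 : Fin n → ℂ))
      ((0 : Fin (n + 1)).insertNth (0 : ℂ) u)
      ((0 : Fin (n + 1)).insertNth (0 : ℂ) (Complex.I • u)) := by
  have hpos : 0 < (star u ⬝ᵥ u).re :=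
    (Complex.pos_iff.1 (Matrix.dotProduct_star_self_pos_iff.2 hu)).1
  have h : fsForm ((0 : Fin (n + 1)).insertNth (1 : ℂ) (0 : Fin n → ℂ))
      ((0 : Fin (n + 1)).insertNth (0 : ℂ) u)
      ((0 : Fin (n + 1)).insertNth (0 : ℂ) (Complex.I • u)) = (star u ⬝ᵥ u).re := by
    simp [fsForm, dotProduct, Fin.sum_univ_succ]
  rwa [h]

/-! ### The frame of a symplectomorphism -/

/-- The base point `[1 : 0 : … : 0]` of `ℂℙⁿ`. -/
noncomputable def basePt (n : ℕ) : CP n := (affineChart 0).symm 0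

theorem affineChart_basePt : affineChart 0 (basePt n) = 0 :=
  (affineChart 0).right_inv (mem_univ _)

theorem idx_basePt : (basePt n).idx = 0 := by
  by_contra h
  obtain ⟨k, hk⟩ := Fin.exists_succ_eq.2 h
  refine (mk_mem_source _ _ _).1 (rep_idx_ne_zero (basePt n)) ?_
  rw [← hk]
  simp

/-- The map `u ↦ (u₁, …, 0, …, uₙ)`, with `0` in the place `i`, the derivative of the local
section of `ℂⁿ⁺¹ ∖ {0} → ℂℙⁿ` over the domain of the `i`-th affine chart. -/
def insertZero (i : Fin (n + 1)) : (Fin n → ℂ) →ₗ[ℂ] (Fin (n + 1) → ℂ) where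
  toFun u := i.insertNth (0 : ℂ) u
  map_add' u v := by
    ext m
    rcases Fin.eq_self_or_eq_succAbove i m with rfl | ⟨k, rfl⟩ <;> simp
  map_smul' c u := by
    ext m
    rcases Fin.eq_self_or_eq_succAbove i m with rfl | ⟨k, rfl⟩ <;> simp

theorem insertZero_apply (i : Fin (n + 1)) (u : Fin n → ℂ) :
    insertZero i u = i.insertNth (0 : ℂ) u := rfl

theorem insertZero_injective (i : Fin (n + 1)) : Function.Injective (insertZero i) := by
  intro u v h
  ext k
  simpa [insertZero_apply] using congrFun h (i.succAbove k)

/-- The vectors `z` and `α e₁, …, α eₙ` of `ℂⁿ⁺¹`, where `α` is the complex-linear part of `D`. -/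
noncomputable def homFrame (z : Fin (n + 1) → ℂ) (D : (Fin n → ℂ) →L[ℝ] (Fin (n + 1) → ℂ)) :
    Fin (n + 1) → Fin (n + 1) → ℂ :=
  Fin.cons z fun k => complexPart (D : (Fin n → ℂ) →ₗ[ℝ] (Fin (n + 1) → ℂ)) (Pi.single k 1)

/-- The differential at the base point of `φ`, read in the charts `0` and `i`. -/
noncomputable def chartDeriv (i : Fin (n + 1)) (φ : CP n → CP n) :
    (Fin n → ℂ) →L[ℝ] (Fin n → ℂ) :=
  fderiv ℝ (affineChart i ∘ φ ∘ (affineChart 0).symm) 0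

/-- The frame of `ℂⁿ⁺¹` given by `φ` in the `i`-th affine chart: a vector spanning the line
`φ [1 : 0 : … : 0]`, followed by lifts of the images of the standard basis under the complex-linear
part of the differential of `φ`. -/
noncomputable def frame (i : Fin (n + 1)) (φ : CP n → CP n) : Fin (n + 1) → Fin (n + 1) → ℂ :=
  Fin.cons (i.insertNth (1 : ℂ) (affineChart i (φ (basePt n)))) fun k =>
    insertZero i (complexPart (chartDeriv i φ : (Fin n → ℂ) →ₗ[ℝ] (Fin n → ℂ)) (Pi.single k 1))

/-- The frame in any chart can be computed from a lift `G` of `φ` to `ℂⁿ⁺¹`. -/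
theorem exists_frame_eq {i : Fin (n + 1)} {φ : CP n → CP n}
    {G : (Fin n → ℂ) → (Fin (n + 1) → ℂ)} {G' : (Fin n → ℂ) →L[ℝ] (Fin (n + 1) → ℂ)}
    (hG : HasFDerivAt G G' 0) (hi : G 0 i ≠ 0)
    (h : affineChart i ∘ φ ∘ (affineChart 0).symm =ᶠ[𝓝 0] affCoord i ∘ G) :
    ∃ s : Fin (n + 1) → ℂ, s 0 = 0 ∧
      ∀ k, frame i φ k = (G 0 i)⁻¹ • homFrame (G 0) G' k + s k • homFrame (G 0) G' 0 := by
  have hD : ∀ u, insertZero i (chartDeriv i φ u) =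
      (G 0 i)⁻¹ • G' u + (-(G' u i) / (G 0 i) ^ 2) • G 0 := by
    intro u
    have hd := ((contDiffAt_affCoord i hi).differentiableAt (by simp)).hasFDerivAt
    rw [chartDeriv, h.fderiv_eq, (hd.comp 0 hG).fderiv]
    exact insertNth_fderiv_affCoord i hi (G' u)
  refine ⟨Fin.cons 0 fun k => -(complexPart (G' : (Fin n → ℂ) →ₗ[ℝ] (Fin (n + 1) → ℂ))
    (Pi.single k 1) i) / (G 0 i) ^ 2, rfl, Fin.cases ?_ fun k => ?_⟩
  · have h0 := h.self_of_nhds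
    simp only [Function.comp_apply] at h0
    simp only [frame, homFrame, Fin.cons_zero, zero_smul, add_zero, basePt, h0]
    exact insertNth_affCoord i _ hi
  · simp only [frame, homFrame, Fin.cons_zero, Fin.cons_succ, complexPart_apply, map_smul, map_sub,
      ContinuousLinearMap.coe_coe, hD]
    simp only [Pi.smul_apply, Pi.sub_apply, smul_eq_mul]
    module

theorem chartDeriv_basePt (φ : CP n ≃ₘ⟮𝓘(ℝ, Fin n → ℂ), 𝓘(ℝ, Fin n → ℂ)⟯ CP n) (u : Fin n → ℂ) :
    (mfderiv 𝓘(ℝ, Fin n → ℂ) 𝓘(ℝ, Fin n → ℂ) φ (basePt n) u : Fin n → ℂ) =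
      chartDeriv (φ (basePt n)).idx φ u := by
  rw [(φ.mdifferentiable (by simp) (basePt n)).mfderiv, modelWithCornersSelf_coe, range_id,
    fderivWithin_univ, chartDeriv]
  change fderiv ℝ (affineChart (φ (basePt n)).idx ∘ φ ∘ (affineChart (basePt n).idx).symm)
    (affineChart (basePt n).idx (basePt n)) u = _
  rw [idx_basePt, affineChart_basePt]

/-- The complex-linear part of the differential of a symplectomorphism is injective, because
`ω (u, i u)` is positive. -/
theorem complexPart_injective (φ : Symp (fubiniStudy (n := n))) :
    Function.Injective (complexPart
      (chartDeriv (φ.1 (basePt n)).idx φ.1 : (Fin n → ℂ) →ₗ[ℝ] (Fin n → ℂ))) := by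
  refine (injective_iff_map_eq_zero _).2 fun u hu => ?_
  by_contra hu0
  have hI := apply_I_smul_of_complexPart_eq_zero hu
  have hpres : fubiniStudy (φ.1 (basePt n))
      (chartDeriv (φ.1 (basePt n)).idx φ.1 u : Fin n → ℂ)
      (chartDeriv (φ.1 (basePt n)).idx φ.1 (Complex.I • u) : Fin n → ℂ) =
      fubiniStudy (basePt n) u (Complex.I • u : Fin n → ℂ) := by
    have := φ.2 (basePt n) u (Complex.I • u : Fin n → ℂ)
    rwa [chartDeriv_basePt, chartDeriv_basePt] at this
  simp only [ContinuousLinearMap.coe_coe] at hI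
  simp only [fubiniStudy, hI, idx_basePt, affineChart_basePt, ← insertZero_apply, map_neg,
    map_smul, fsForm_neg_right] at hpres
  have h1 := fsForm_smul_I_nonneg
    ((φ.1 (basePt n)).idx.insertNth (1 : ℂ) (affineChart (φ.1 (basePt n)).idx (φ.1 (basePt n))))
    (insertZero (φ.1 (basePt n)).idx (chartDeriv (φ.1 (basePt n)).idx φ.1 u))
  have h2 := fsForm_base_pos hu0
  simp only [← insertZero_apply, map_smul] at h2
  linarith

theorem frame_linearIndependent_idx (φ : Symp (fubiniStudy (n := n))) :
    LinearIndependent ℂ (frame (φ.1 (basePt n)).idx φ.1) := by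
  set i := (φ.1 (basePt n)).idx with hi
  refine linearIndependent_finCons.2 ⟨?_, fun hmem => ?_⟩
  · simpa [Function.comp_def] using (Pi.basisFun ℂ (Fin n)).linearIndependent.map' (insertZero i ∘ₗ complexPart
      (chartDeriv i φ.1 : (Fin n → ℂ) →ₗ[ℝ] (Fin n → ℂ)))
      (LinearMap.ker_eq_bot.2 ((insertZero_injective i).comp (complexPart_injective φ)))
  · have hle : Submodule.span ℂ (range fun k => insertZero i (complexPart
        (chartDeriv i φ.1 : (Fin n → ℂ) →ₗ[ℝ] (Fin n → ℂ)) (Pi.single k 1))) ≤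
        LinearMap.ker (LinearMap.proj (R := ℂ) (φ := fun _ : Fin (n + 1) => ℂ) i) := by
      rw [Submodule.span_le]
      rintro _ ⟨k, rfl⟩
      simp [insertZero_apply]
    simpa using hle hmem

/-! ### Independence of the chart -/

theorem affineChart_eq_affCoord {i j : Fin (n + 1)} {p : CP n} (hp : p ∈ (affineChart j).source) :
    affineChart i p = affCoord i (j.insertNth (1 : ℂ) (affineChart j p)) := by
  conv_lhs => rw [← (affineChart j).left_inv hp, affineChart_symm]
  rfl

theorem hasFDerivAt_insertNth_one (i : Fin (n + 1)) (x : Fin n → ℂ) :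
    HasFDerivAt (fun x : Fin n → ℂ => (i.insertNth (1 : ℂ) x : Fin (n + 1) → ℂ))
      (LinearMap.toContinuousLinearMap ((insertZero i).restrictScalars ℝ)) x := by
  refine HasFDerivAt.congr_of_eventuallyEq (f := fun x => i.insertNth (1 : ℂ) (0 : Fin n → ℂ) +
      LinearMap.toContinuousLinearMap ((insertZero i).restrictScalars ℝ) x)
    ((ContinuousLinearMap.hasFDerivAt _).const_add _) (Filter.Eventually.of_forall fun x => ?_)
  ext m
  rcases Fin.eq_self_or_eq_succAbove i m with rfl | ⟨k, rfl⟩ <;> simp [insertZero_apply]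

/-- The frames of a diffeomorphism in two affine charts agree up to a common factor and up to
multiples of the first vector. -/
theorem exists_frame_eq_frame (φ : CP n ≃ₘ⟮𝓘(ℝ, Fin n → ℂ), 𝓘(ℝ, Fin n → ℂ)⟯ CP n)
    {i j : Fin (n + 1)} (hi : φ (basePt n) ∈ (affineChart i).source)
    (hj : φ (basePt n) ∈ (affineChart j).source) :
    ∃ c ≠ (0 : ℂ), ∃ s : Fin (n + 1) → ℂ, s 0 = 0 ∧
      ∀ k, frame i φ k = c • frame j φ k + s k • frame j φ 0 := by
  have hcd : ContDiffAt ℝ ∞ (affineChart j ∘ φ ∘ (affineChart 0).symm) 0 := by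
    rw [← contMDiffAt_iff_contDiffAt]
    exact (contMDiffAt_of_mem_maximalAtlas (IsManifold.subset_maximalAtlas (mem_range_self j))
      hj).comp 0 (φ.contMDiff.contMDiffAt.comp 0 (contMDiffAt_symm_of_mem_maximalAtlas
        (IsManifold.subset_maximalAtlas (mem_range_self 0)) (mem_univ _)))
  have hG := (hasFDerivAt_insertNth_one j _).comp (0 : Fin n → ℂ)
    (hcd.differentiableAt (by simp)).hasFDerivAt
  have hcont : ContinuousAt (φ ∘ (affineChart 0).symm) 0 :=
    φ.continuous.continuousAt.comp ((affineChart 0).symm.continuousAt (mem_univ _))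
  have hev : ∀ᶠ x in 𝓝 0, φ ((affineChart 0).symm x) ∈ (affineChart j).source :=
    hcont.eventually ((affineChart j).open_source.mem_nhds hj)
  have hne : (j.insertNth (1 : ℂ) (affineChart j (φ (basePt n))) : Fin (n + 1) → ℂ) i ≠ 0 := by
    rw [← (affineChart j).left_inv hj, affineChart_symm, mk_mem_source] at hi
    exact hi
  obtain ⟨s, hs, h⟩ := exists_frame_eq (φ := φ) hG hne (by
    filter_upwards [hev] with x hx
    exact affineChart_eq_affCoord hx)
  refine ⟨_, inv_ne_zero hne, s, hs, fun k => ?_⟩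
  have hom : homFrame (j.insertNth (1 : ℂ) (affineChart j (φ (basePt n))))
      (LinearMap.toContinuousLinearMap ((insertZero j).restrictScalars ℝ) ∘L chartDeriv j φ) =
      frame j φ := by
    refine congrArg (Fin.cons _) (funext fun k => ?_)
    simp [complexPart_apply]
  rw [← hom]
  exact h k

theorem frame_linearIndependent (φ : Symp (fubiniStudy (n := n))) {i : Fin (n + 1)}
    (hi : φ.1 (basePt n) ∈ (affineChart i).source) : LinearIndependent ℂ (frame i φ.1) := by
  obtain ⟨c, hc, s, hs, h⟩ := exists_frame_eq_frame φ.1 hi (rep_idx_ne_zero _)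
  exact PU.linearIndependent_smul_add (frame_linearIndependent_idx φ) hc hs h

/-! ### The retraction of the symplectomorphism group onto the projective unitary group -/

/-- The element of `PU(n+1)` obtained from the frame of a symplectomorphism at the base point by
the Gram–Schmidt process. -/
noncomputable def retraction (φ : Symp (fubiniStudy (n := n))) : PU (n + 1) :=
  PU.ofFrame (frame (φ.1 (basePt n)).idx φ.1)

theorem retraction_eq (φ : Symp (fubiniStudy (n := n))) {i : Fin (n + 1)}
    (hi : φ.1 (basePt n) ∈ (affineChart i).source) : retraction φ = PU.ofFrame (frame i φ.1) := by
  obtain ⟨c, hc, s, hs, h⟩ := exists_frame_eq_frame φ.1 (rep_idx_ne_zero _) hi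
  exact PU.ofFrame_smul_add (frame_linearIndependent φ hi) hc hs h

/-- The columns of `A` are a frame of the projective transformation given by `A`. -/
theorem retraction_unitaryHom (A : Matrix.unitaryGroup (Fin (n + 1)) ℂ) :
    retraction (unitaryHom n A) = QuotientGroup.mk (s := scalarUnitary (n + 1)) A := by
  set i := (unitaryMap A (basePt n)).idx with hidx
  let L : (Fin (n + 1) → ℂ) →L[ℝ] (Fin (n + 1) → ℂ) :=
    LinearMap.toContinuousLinearMap (A.1.mulVecLin.restrictScalars ℝ)
  have hG := L.hasFDerivAt.comp (0 : Fin n → ℂ) (hasFDerivAt_insertNth_one 0 0)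
  have hne : (A.1 *ᵥ ((0 : Fin (n + 1)).insertNth (1 : ℂ) (0 : Fin n → ℂ))) i ≠ 0 := by
    have := (mulVec_affineChart_ne_zero A (i := 0) (j := i)
      ((affineChart 0).map_target (mem_univ 0))).1 (rep_idx_ne_zero (unitaryMap A (basePt n)))
    rwa [show affineChart 0 ((affineChart 0).symm 0) = 0 from affineChart_basePt] at this
  obtain ⟨s, hs, h⟩ := exists_frame_eq (i := i) (φ := unitaryMap A) hG hne
    (Filter.EventuallyEq.of_eq (unitaryMap_chart A 0 i))
  have hsingle : ∀ k : Fin n, insertZero 0 (Pi.single k (1 : ℂ)) = Pi.single k.succ 1 := by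
    intro k
    ext m
    refine Fin.cases ?_ (fun l => ?_) m
    · simp [insertZero_apply]
    · simp [insertZero_apply, Pi.single_apply]
  have hone : ((0 : Fin (n + 1)).insertNth (1 : ℂ) (0 : Fin n → ℂ) : Fin (n + 1) → ℂ) =
      Pi.single 0 1 := by
    ext m
    refine Fin.cases ?_ (fun l => ?_) m <;> simp
  have hom : homFrame (A.1 *ᵥ ((0 : Fin (n + 1)).insertNth (1 : ℂ) (0 : Fin n → ℂ)))
      (L ∘L LinearMap.toContinuousLinearMap ((insertZero 0).restrictScalars ℝ)) = A.1.col := by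
    funext k
    refine Fin.cases ?_ (fun k => ?_) k
    · rw [homFrame, Fin.cons_zero, hone, Matrix.mulVec_single_one]
    · rw [homFrame, Fin.cons_succ, complexPart_of_commute]
      · simp [L, hsingle]
      · intro u
        simp [L]
  have hA : LinearIndependent ℂ A.1.col := by
    rw [Matrix.linearIndependent_cols_iff_isUnit]
    exact (Unitary.toUnits A).isUnit
  refine (PU.ofFrame_smul_add hA (inv_ne_zero hne) hs fun k => ?_).trans
    (congrArg _ (PU.unitarize_col A))
  rw [← hom]
  exact h k

theorem retraction_puHom (a : PU (n + 1)) : retraction (puHom n a) = a := by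
  induction a using QuotientGroup.induction_on with | H A =>
  exact retraction_unitaryHom A

/-! ### Continuity of the retraction -/

/-- In the `C^∞` topology, values and first derivatives at the base point vary continuously. -/
theorem eventually_chart_lt (φ : CP n ≃ₘ⟮𝓘(ℝ, Fin n → ℂ), 𝓘(ℝ, Fin n → ℂ)⟯ CP n) {i : Fin (n + 1)}
    (hi : φ (basePt n) ∈ (affineChart i).source) {ε : ℝ} (hε : 0 < ε) :
    ∀ᶠ ψ : CP n ≃ₘ⟮𝓘(ℝ, Fin n → ℂ), 𝓘(ℝ, Fin n → ℂ)⟯ CP n in 𝓝 φ,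
      ψ (basePt n) ∈ (affineChart i).source ∧
      ‖affineChart i (ψ (basePt n)) - affineChart i (φ (basePt n))‖ < ε ∧
      ∀ u, ‖chartDeriv i ψ u - chartDeriv i φ u‖ ≤ ε * ‖u‖ := by
  have hmem : ∀ ψ : CP n ≃ₘ⟮𝓘(ℝ, Fin n → ℂ), 𝓘(ℝ, Fin n → ℂ)⟯ CP n,
      MapsTo ψ ((affineChart 0).symm '' {0}) (affineChart i).source ↔
        ψ (basePt n) ∈ (affineChart i).source := fun ψ => by
    simp [MapsTo, basePt]
  have hopen : IsOpen (Diffeomorph.cInftyNhd φ (affineChart 0) (affineChart i) {0} 1 ε) :=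
    TopologicalSpace.isOpen_generateFrom_of_mem ⟨φ, affineChart 0, affineChart i, {0}, 1, ε,
      IsManifold.subset_maximalAtlas (mem_range_self 0),
      IsManifold.subset_maximalAtlas (mem_range_self i), isCompact_singleton,
      subset_univ _, (hmem φ).2 hi, hε, rfl⟩
  have hφ : φ ∈ Diffeomorph.cInftyNhd φ (affineChart 0) (affineChart i) {0} 1 ε :=
    ⟨(hmem φ).2 hi, fun k _ x _ => by simpa using hε⟩
  filter_upwards [hopen.mem_nhds hφ] with ψ hψ
  refine ⟨(hmem ψ).1 hψ.1, ?_, fun u => ?_⟩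
  · refine lt_of_le_of_lt ?_ (hψ.2 0 zero_le_one 0 rfl)
    simpa [basePt] using (iteratedFDeriv ℝ 0 (affineChart i ∘ ψ ∘ (affineChart 0).symm) 0 -
      iteratedFDeriv ℝ 0 (affineChart i ∘ φ ∘ (affineChart 0).symm) 0).le_opNorm 0
  · have h := (iteratedFDeriv ℝ 1 (affineChart i ∘ ψ ∘ (affineChart 0).symm) 0 -
      iteratedFDeriv ℝ 1 (affineChart i ∘ φ ∘ (affineChart 0).symm) 0).le_of_opNorm_le
        (hψ.2 1 le_rfl 0 rfl).le (fun _ => u)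
    simpa [iteratedFDeriv_one_apply, chartDeriv] using h

theorem continuousAt_frame (φ : Symp (fubiniStudy (n := n))) {i : Fin (n + 1)}
    (hi : φ.1 (basePt n) ∈ (affineChart i).source) :
    ContinuousAt (fun ψ : Symp (fubiniStudy (n := n)) => frame i ψ.1) φ := by
  have hval : ContinuousAt
      (fun ψ : Symp (fubiniStudy (n := n)) => affineChart i (ψ.1 (basePt n))) φ := by
    refine Metric.continuousAt_iff'.2 fun ε hε => ?_
    filter_upwards [continuous_subtype_val.continuousAt.eventually
      (eventually_chart_lt φ.1 hi hε)] with ψ hψ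
    rw [dist_eq_norm]
    exact hψ.2.1
  have hder : ∀ u, ContinuousAt
      (fun ψ : Symp (fubiniStudy (n := n)) => chartDeriv i ψ.1 u) φ := fun u => by
    refine Metric.continuousAt_iff'.2 fun ε hε => ?_
    have hδ : 0 < ε / (‖u‖ + 1) := by positivity
    filter_upwards [continuous_subtype_val.continuousAt.eventually
      (eventually_chart_lt φ.1 hi hδ)] with ψ hψ
    rw [dist_eq_norm]
    refine (hψ.2.2 u).trans_lt ?_
    rw [div_mul_eq_mul_div, div_lt_iff₀ (by positivity)]
    nlinarith
  refine continuousAt_pi.2 (Fin.cases ?_ fun k => ?_)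
  · exact (continuous_insertNth i 1).continuousAt.comp hval
  · refine (continuous_insertNth i 0).continuousAt.comp (x := φ) ?_
    exact ((hder (Pi.single k 1)).sub ((hder (Complex.I • Pi.single k 1)).const_smul
      Complex.I)).const_smul (2 : ℂ)⁻¹

theorem continuous_retraction : Continuous (retraction (n := n)) := by
  refine continuous_iff_continuousAt.2 fun φ => ?_
  set i := (φ.1 (basePt n)).idx with hidx
  have hi : φ.1 (basePt n) ∈ (affineChart i).source := rep_idx_ne_zero _
  have hev : ∀ᶠ ψ : Symp (fubiniStudy (n := n)) in 𝓝 φ,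
      ψ.1 (basePt n) ∈ (affineChart i).source :=
    (continuous_subtype_val.continuousAt.eventually (eventually_chart_lt φ.1 hi one_pos)).mono
      fun _ h => h.1
  have hcont : ContinuousAt
      (fun ψ : Symp (fubiniStudy (n := n)) => PU.ofFrame (frame i ψ.1)) φ :=
    (QuotientGroup.isQuotientMap_mk (scalarUnitary (n + 1))).continuous.continuousAt.comp
      (PU.continuousAt_unitarize (continuousAt_frame φ hi)
        (hev.mono fun ψ hψ => frame_linearIndependent ψ hψ))
  exact hcont.congr (hev.mono fun ψ hψ => (retraction_eq ψ hψ).symm)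

end CP

/-! ### Homotopy groups -/

/-- A map with a continuous left inverse is injective on homotopy groups. -/
theorem homotopyGroupMap_injective_of_leftInverse (N : Type*) {X Y : Type*} [TopologicalSpace X]
    [TopologicalSpace Y] (f : C(X, Y)) {x : X} {y : Y} (h : f x = y) (r : C(Y, X))
    (hr : Function.LeftInverse r f) : Function.Injective (homotopyGroupMap N f h) := by
  have hy : r y = x := h ▸ hr x
  refine Function.LeftInverse.injective (g := homotopyGroupMap N r hy) fun a => ?_
  induction a using Quotient.inductionOn with | h γ =>
  exact congrArg (Quotient.mk _) (Subtype.ext (ContinuousMap.ext fun t => hr (γ.1 t)))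

theorem theorem2 (n j : ℕ) (hj : j ≤ 2 * n + 1) :
    Function.Injective
      (homotopyGroupMap (Fin j) (CP.puMap n) (map_one (CP.puHom n)) :
        π_ j (PU (n + 1)) 1 → π_ j (Symp (CP.fubiniStudy (n := n))) 1) :=
  homotopyGroupMap_injective_of_leftInverse (Fin j) (CP.puMap n) _
    ⟨CP.retraction, CP.continuous_retraction⟩ CP.retraction_puHom
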